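/- Fix a lattice $x\in x_0+\eta\mathbb Z$ and infinitely many times ${\bf t}=(t_1,t_2,\dots)$, $\bar{\bf t}=(\bar t_1,\bar t_2,\dots)$; functions of the times are formal power series over $\mathbb C$ (Taylor series at a point of the submanifold ${\bf t}+\bar{\bf t}=0$ where the tau-functions do not vanish, taken as the origin). Put $\xi({\bf t},k)=\sum_{j\ge1}t_jk^j$ and ${\bf t}\pm[k]=(t_j\pm k^j/j)_{j\ge1}$. Let $\tau^T(x,{\bf t},\bar{\bf t})$ be a 2D Toda tau-function, i.e. for all $x,x'\in x_0+\eta\mathbb Z$ and all ${\bf t},\bar{\bf t},{\bf t}',\bar{\bf t}'$ $$\oint_{C_\infty}k^{\frac{x-x'}{\eta}-1}e^{\xi({\bf t},k)-\xi({\bf t}',k)}\tau^T(x,{\bf t}-[k^{-1}],\bar{\bf t})\,\tau^T(x'+\eta,{\bf t}'+[k^{-1}],\bar{\bf t}')\,dk =\oint_{C_0}k^{\frac{x-x'}{\eta}-1}e^{\xi(\bar{\bf t},k^{-1})-\xi(\bar{\bf t}',k^{-1})}\tau^T(x+\eta,{\bf t},\bar{\bf t}-[k])\,\tau^T(x',{\bf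 t}',\bar{\bf t}'+[k])\,dk ,$$ with both contour integrals read as coefficients of $k^{-1}$. Let $e^{\varphi(x)}=\tau^T(x+\eta)/\tau^T(x)$, let $$\psi=k^{x/\eta}e^{\xi({\bf t},k)}\frac{\tau^T(x,{\bf t}-[k^{-1}],\bar{\bf t})}{\tau^T(x,{\bf t},\bar{\bf t})}\ (k\to\infty),\qquad \psi=k^{x/\eta}e^{\xi(\bar{\bf t},k^{-1})}\frac{\tau^T(x+\eta,{\bf t},\bar{\bf t}-[k])}{\tau^T(x,{\bf t},\bar{\bf t})}\ (k\to0)$$ be the wave function, $\mathcal W$, $\bar{\mathcal W}$ the wave operators given by $\psi=\mathcal W k^{x/\eta}e^{\xi({\bf t},k)}$ and $\psi=\bar{\mathcal W}k^{x/\eta}e^{\xi(\bar{\bf t},k^{-1})}$ respectively, and $\mathcal L=\mathcal We^{\eta\partial_x}\mathcal W^{-1}$, $\bar{\mathcal L}=\bar{\mathcal W}e^{-\eta\partial_x}\bar{\mathcal W}^{-1}$ the Lax operators. Suppose that $\tau^T$ gives a C-Toda solution: on ${\bf t}+\bar{\bf t}=0$ the operators in the symmetric gauge, $\mathcal L^s=e^{-\varphi/2}\mathcal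 Le^{\varphi/2}$ and $\bar{\mathcal L}^s=e^{-\varphi/2}\bar{\mathcal L}e^{\varphi/2}$, satisfy $\bar{\mathcal L}^s=(\mathcal L^s)^\dagger$, where $(f(x)e^{n\eta\partial_x})^\dagger=e^{-n\eta\partial_x}f(x)$. Let $\tau^C(x,{\bf t})$ be a tau-function of this C-Toda solution, i.e., with $\psi(x,{\bf t};k)=\psi(x,{\bf t},-{\bf t};k)$ and $\varphi(x,{\bf t})=\varphi(x,{\bf t},-{\bf t})$, as $k\to\infty$, $$\psi(x,{\bf t};k)=e^{\frac12\varphi(x,{\bf t})}\sqrt{\chi^2(x,{\bf t};k)-\chi^2(x-\eta,{\bf t};k)},\qquad \psi(x,{\bf t};k^{-1})=e^{\frac12\varphi(x,{\bf t})}\sqrt{\bar\chi^2(x,{\bf t};k)-\bar\chi^2(x+\eta,{\bf t};k)},$$ $$\chi=k^{x/\eta}e^{\xi({\bf t},k)-\frac12\varphi(x,{\bf t})}\frac{\tau^C(x,{\bf t}-[k^{-1}])}{\tau^C(x,{\bf t})},\quad \bar\chi=k^{-x/\eta}e^{-\xi({\bf t},k)}\frac{\tau^C(x+\eta,{\bf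 t}+[k^{-1}])}{\tau^C(x,{\bf t})},\quad e^{\varphi(x,{\bf t})}=\left(\frac{\tau^C(x+\eta,{\bf t})}{\tau^C(x,{\bf t})}\right)^2 .$$ Then there is a nonzero constant $C\in\mathbb C$, independent of $x$ and ${\bf t}$, such that $$\tau^T(x,{\bf t},-{\bf t})=C\,\bigl(\tau^C(x,{\bf t})\bigr)^2\qquad\text{for all }x\in x_0+\eta\mathbb Z\text{ and all }{\bf t}.$$ -/

import Mathlib

noncomputable section

namespace CToda

/-! Conventions. The space variable runs over a lattice `x = x₀ + n η`, `n : ℤ`, and functions of `x`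
are functions of the site `n`. The times are `t_j` and `tbar_j`, `j : ℕ+`, and functions of the times
are formal power series in them over `ℂ` (Taylor expansions at a point of the submanifold
`t + tbar = 0`, taken as the origin).

The letter `z` is the local parameter on the spectral `k`-sphere:
`z = k⁻¹` for expansions at `k = ∞`, and `z = k` for expansions at `k = 0`. -/

/-- Index set of the full set of times: `Sum.inl j` is `t_j`, `Sum.inr j` is `tbar_j`. -/
abbrev TodaTimes : Type := ℕ+ ⊕ ℕ+

/-- Formal series in the times (indexed by `σ`) with coefficients in `ℂ((z))`. Both
`exp (∑ t_j z⁻ʲ)` and the factors `τ(t - [z])` live here. -/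
abbrev WaveSeries (σ : Type) : Type := MvPowerSeries σ (LaurentSeries ℂ)

/-- The point of the time space with coordinates `e j`, as series in the times `σ` (variables
`some s`) and in `z` (the variable `none`). -/
def time {σ : Type} (e : ℕ+ → σ) : ℕ+ → MvPowerSeries (Option σ) ℂ :=
  fun j => MvPowerSeries.X (some (e j))

/-- The Miwa vector `[z] = (z, z²/2, z³/3, …)`. -/
def miwa {σ : Type} : ℕ+ → MvPowerSeries (Option σ) ℂ :=
  fun j => MvPowerSeries.C (1 / ((j : ℕ) : ℂ)) * MvPowerSeries.X none ^ (j : ℕ)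

/-- Reads a power series in the times and `z` as a series in the times with coefficients in
`ℂ[[z]] ⊆ ℂ((z))`. -/
def expandZ {σ : Type} (F : MvPowerSeries (Option σ) ℂ) : WaveSeries σ :=
  fun α => HahnSeries.ofPowerSeries ℤ ℂ
    (PowerSeries.mk fun l =>
      MvPowerSeries.coeff (α.mapDomain some + Finsupp.single none l) F)

/-- `F(t)`, for a series `F` in one set of times and a point `t` that may involve `z`. -/
def eval₁ {σ : Type} (F : MvPowerSeries ℕ+ ℂ) (t : ℕ+ → MvPowerSeries (Option σ) ℂ) :
    WaveSeries σ :=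
  expandZ (MvPowerSeries.subst t F)

/-- `F(t, tbar)`, for a series `F` in both sets of times. -/
def eval₂ {σ : Type} (F : MvPowerSeries TodaTimes ℂ)
    (t tbar : ℕ+ → MvPowerSeries (Option σ) ℂ) : WaveSeries σ :=
  expandZ (MvPowerSeries.subst (Sum.elim t tbar) F)

/-- The monomial `z ^ m`, `m : ℤ`. -/
def zpow {σ : Type} (m : ℤ) : WaveSeries σ := MvPowerSeries.C (HahnSeries.single m 1)

/-- The coefficient of `z ^ m`, a series in the times. -/
def coeffZ {σ : Type} (m : ℤ) (F : WaveSeries σ) : MvPowerSeries σ ℂ :=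
  fun α => (MvPowerSeries.coeff α F).coeff m

/-- `∑_j t_j z⁻ʲ`: this is `ξ(t, k)` at `k = ∞` and `ξ(t, k⁻¹)` at `k = 0`. -/
def xi {σ : Type} (t : ℕ+ → MvPowerSeries (Option σ) ℂ) : WaveSeries σ :=
  fun α => ∑ᶠ j : ℕ+,
    HahnSeries.single (-(j : ℤ)) (1 : ℂ) * MvPowerSeries.coeff α (expandZ (t j))

/-- The exponential of a series without constant term. -/
def expSeries {σ : Type} (F : WaveSeries σ) : WaveSeries σ :=
  PowerSeries.subst F (PowerSeries.exp ℂ)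

/-! ### The 2D Toda lattice -/

/-- The bilinear relation of the 2D Toda lattice. The independent variables are
`t, tbar, t', tbar'`; the contour integral (divided by `2πi`) over `C_∞` is the coefficient of
`k⁻¹ = z`, the one over `C_0` is the coefficient of `k⁻¹ = z⁻¹`. -/
def Bilinear (τ : ℤ → MvPowerSeries TodaTimes ℂ) : Prop :=
  let t : ℕ+ → MvPowerSeries (Option (TodaTimes ⊕ TodaTimes)) ℂ :=
    time fun j => Sum.inl (Sum.inl j)
  let tbar : ℕ+ → MvPowerSeries (Option (TodaTimes ⊕ TodaTimes)) ℂ :=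
    time fun j => Sum.inl (Sum.inr j)
  let t' : ℕ+ → MvPowerSeries (Option (TodaTimes ⊕ TodaTimes)) ℂ :=
    time fun j => Sum.inr (Sum.inl j)
  let tbar' : ℕ+ → MvPowerSeries (Option (TodaTimes ⊕ TodaTimes)) ℂ :=
    time fun j => Sum.inr (Sum.inr j)
  ∀ n n' : ℤ,
    coeffZ 1 (zpow (-(n - n' - 1)) * expSeries (xi t - xi t') *
        eval₂ (τ n) (t - miwa) tbar * eval₂ (τ (n' + 1)) (t' + miwa) tbar') =
      coeffZ (-1) (zpow (n - n' - 1) * expSeries (xi tbar - xi tbar') *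
        eval₂ (τ (n + 1)) t (tbar - miwa) * eval₂ (τ n') t' (tbar' + miwa))

/-- Tau-functions of the 2D Toda lattice hierarchy, regular and nonzero at the expansion point. -/
structure IsTodaTau (τ : ℤ → MvPowerSeries TodaTimes ℂ) : Prop where
  ne_zero : ∀ n, MvPowerSeries.constantCoeff (τ n) ≠ 0
  bilinear : Bilinear τ

/-- `e^{φ(n)} = τ(n + 1) / τ(n)`. -/
def expPhi (τ : ℤ → MvPowerSeries TodaTimes ℂ) (n : ℤ) : MvPowerSeries TodaTimes ℂ :=
  τ (n + 1) * (τ n)⁻¹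

/-- `τ(n, t - [k⁻¹], tbar) / τ(n, t, tbar)`, with `z = k⁻¹`. -/
def wInf {σ : Type} (τ : ℤ → MvPowerSeries TodaTimes ℂ) (n : ℤ)
    (t tbar : ℕ+ → MvPowerSeries (Option σ) ℂ) : WaveSeries σ :=
  eval₂ (τ n) (t - miwa) tbar * (eval₂ (τ n) t tbar)⁻¹

/-- `τ(n + 1, t, tbar - [k]) / τ(n, t, tbar)`, with `z = k`. -/
def wZero {σ : Type} (τ : ℤ → MvPowerSeries TodaTimes ℂ) (n : ℤ)
    (t tbar : ℕ+ → MvPowerSeries (Option σ) ℂ) : WaveSeries σ :=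
  eval₂ (τ (n + 1)) t (tbar - miwa) * (eval₂ (τ n) t tbar)⁻¹

/-- The wave function `ψ(n, t, tbar; k)` at `k → ∞`, with `z = k⁻¹`. The factor `k^{x₀/η}`, common
to all sites, is omitted. -/
def psiInf {σ : Type} (τ : ℤ → MvPowerSeries TodaTimes ℂ) (n : ℤ)
    (t tbar : ℕ+ → MvPowerSeries (Option σ) ℂ) : WaveSeries σ :=
  zpow (-n) * expSeries (xi t) * wInf τ n t tbar

/-- The wave function `ψ(n, t, tbar; k)` at `k → 0`, with `z = k`. -/
def psiZero {σ : Type} (τ : ℤ → MvPowerSeries TodaTimes ℂ) (n : ℤ)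
    (t tbar : ℕ+ → MvPowerSeries (Option σ) ℂ) : WaveSeries σ :=
  zpow n * expSeries (xi tbar) * wZero τ n t tbar

/-! ### Pseudo-difference operators and the C-Toda constraint -/

/-- A formal difference operator `∑_m a_m(n) e^{mη∂}`; `a m n` is the value at the site `n` of the
coefficient of the shift by `m`. -/
abbrev DiffOp (A : Type) : Type := ℤ → ℤ → A

/-- Composition. The sum is finite when the orders of both factors are bounded above, or both
bounded below; it is only used in these cases. -/
def DiffOp.comp {A : Type} [CommRing A] (a b : DiffOp A) : DiffOp A :=
  fun m n => ∑ᶠ i : ℤ, a i n * b (m - i) (n + i)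

/-- The shift `e^{pη∂}`. -/
def DiffOp.shift {A : Type} [CommRing A] (p : ℤ) : DiffOp A :=
  fun m _ => if m = p then 1 else 0

/-- The adjoint: `(f e^{mη∂})† = e^{-mη∂} ∘ f`. -/
def DiffOp.adjoint {A : Type} (a : DiffOp A) : DiffOp A :=
  fun m n => a (-m) (n + m)

/-- The gauge transformation `a ↦ g⁻¹ a g` by a function `g`. -/
def DiffOp.gauge {σ : Type} (g : ℤ → MvPowerSeries σ ℂ) (a : DiffOp (MvPowerSeries σ ℂ)) :
    DiffOp (MvPowerSeries σ ℂ) :=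
  fun m n => (g n)⁻¹ * a m n * g (n + m)

/-- The wave operator `W = ∑_{s ≥ 0} ξ_s(n) e^{-sη∂}`. -/
def waveOp (τ : ℤ → MvPowerSeries TodaTimes ℂ) : DiffOp (MvPowerSeries TodaTimes ℂ) :=
  fun m n => coeffZ (-m) (wInf τ n (time Sum.inl) (time Sum.inr))

/-- The wave operator `Wbar = e^{φ(n)} ∑_{s ≥ 0} χ_s(n) e^{sη∂}`. -/
def waveOpBar (τ : ℤ → MvPowerSeries TodaTimes ℂ) : DiffOp (MvPowerSeries TodaTimes ℂ) :=
  fun m n => coeffZ m (wZero τ n (time Sum.inl) (time Sum.inr))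

/-- `L` and `Lbar` are the Lax operators of `τ` in the standard gauge:
`L = e^{η∂} + ∑_{k ≥ 0} U_k e^{-kη∂} = W e^{η∂} W⁻¹` and
`Lbar = c e^{-η∂} + ∑_{k ≥ 0} Ubar_k e^{kη∂} = Wbar e^{-η∂} Wbar⁻¹`. -/
structure IsLaxPair (τ : ℤ → MvPowerSeries TodaTimes ℂ)
    (L Lbar : DiffOp (MvPowerSeries TodaTimes ℂ)) : Prop where
  order : ∀ m n, 1 < m → L m n = 0
  leading : ∀ n, L 1 n = 1
  dressing : L.comp (waveOp τ) = (waveOp τ).comp (DiffOp.shift 1)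
  order_bar : ∀ m n, m < -1 → Lbar m n = 0
  dressing_bar : Lbar.comp (waveOpBar τ) = (waveOpBar τ).comp (DiffOp.shift (-1))

/-- Restriction to the submanifold `tbar = -t`, on which `T_j = t_j`. -/
def restrict (F : MvPowerSeries TodaTimes ℂ) : MvPowerSeries ℕ+ ℂ :=
  MvPowerSeries.subst
    (Sum.elim (fun j => MvPowerSeries.X j) (fun j => -MvPowerSeries.X j) :
      TodaTimes → MvPowerSeries ℕ+ ℂ) F

/-- `τ` is the 2D Toda tau-function of a solution of the C-Toda hierarchy: on the submanifold
`t + tbar = 0` the Lax operators in the symmetric gauge (the gauge by `g = e^{φ/2}`) satisfy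
`Lbarˢ = (Lˢ)†`. -/
structure IsCTodaSolution (τ : ℤ → MvPowerSeries TodaTimes ℂ) : Prop where
  toda : IsTodaTau τ
  constraint : ∃ (L Lbar : DiffOp (MvPowerSeries TodaTimes ℂ))
      (g : ℤ → MvPowerSeries TodaTimes ℂ),
    IsLaxPair τ L Lbar ∧ (∀ n, g n ^ 2 = expPhi τ n) ∧
    ∀ m n, restrict (DiffOp.gauge g Lbar m n) = restrict ((DiffOp.gauge g L).adjoint m n)

/-! ### The tau-function of the C-Toda hierarchy -/

/-- A series in the times viewed as a series with `z`-independent coefficients. -/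
def const {σ : Type} (F : MvPowerSeries σ ℂ) : WaveSeries σ :=
  MvPowerSeries.map (algebraMap ℂ (LaurentSeries ℂ)) F

/-- The function
`χ(n, t; k) = kⁿ e^{ξ(t, k)} e^{-φ(n, t)/2} τC(n, t - [k⁻¹]) / τC(n, t)`, where `h = e^{φ/2}`. -/
def chi (τC h : ℤ → MvPowerSeries ℕ+ ℂ) (n : ℤ) : WaveSeries ℕ+ :=
  zpow (-n) * expSeries (xi (time id)) * (const (h n))⁻¹ *
    eval₁ (τC n) (time id - miwa) * (eval₁ (τC n) (time id))⁻¹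

/-- The function `χbar(n, t; k) = k⁻ⁿ e^{-ξ(t, k)} τC(n + 1, t + [k⁻¹]) / τC(n, t)`. -/
def chiBar (τC : ℤ → MvPowerSeries ℕ+ ℂ) (n : ℤ) : WaveSeries ℕ+ :=
  zpow n * expSeries (-xi (time id)) *
    eval₁ (τC (n + 1)) (time id + miwa) * (eval₁ (τC n) (time id))⁻¹

/-- `τC` is a tau-function of the C-Toda hierarchy for the solution with 2D Toda tau-function `τT`:
with `ψ(n, t; k) = ψ(n, t, -t; k)` and `h = e^{φ/2}`, as `k → ∞`,
`ψ(n, t; k) = e^{φ/2} √(χ(n)² - χ(n - 1)²)`, `ψ(n, t; k⁻¹) = e^{φ/2} √(χbar(n)² - χbar(n + 1)²)`,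
and `e^{φ(n, t)} = (τC(n + 1, t) / τC(n, t))²`.
Here `√f` denotes a square root of `f`; the branch is fixed by the leading terms of the
left-hand sides. -/
structure IsCTodaTau (τT : ℤ → MvPowerSeries TodaTimes ℂ) (τC : ℤ → MvPowerSeries ℕ+ ℂ) :
    Prop where
  ne_zero : ∀ n, MvPowerSeries.constantCoeff (τC n) ≠ 0
  expPhi_eq : ∀ n, restrict (expPhi τT n) = (τC (n + 1) * (τC n)⁻¹) ^ 2
  wave : ∃ h : ℤ → MvPowerSeries ℕ+ ℂ, (∀ n, h n ^ 2 = restrict (expPhi τT n)) ∧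
    (∀ n, ∃ s : WaveSeries ℕ+, s ^ 2 = chi τC h n ^ 2 - chi τC h (n - 1) ^ 2 ∧
      psiInf τT n (time id) (-time id) = const (h n) * s) ∧
    (∀ n, ∃ s : WaveSeries ℕ+, s ^ 2 = chiBar τC n ^ 2 - chiBar τC (n + 1) ^ 2 ∧
      psiZero τT n (time id) (-time id) = const (h n) * s)

end CToda

end

noncomputable section

namespace CToda

open MvPowerSeries

/-! ### Substitutions -/

/-! Write T(n,t) for τT(n,t,-t) and z for the local parameter. Squaring the relation at k → ∞
cancels the exponentials and expresses τT(n,t-[z],-t)² through T(n,t)² and a bracket K in τC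
(`shift_inf`). The relation at k → 0, taken one site lower, does the same for τT(n,t,-t-[z])²
(`shift_zero`). The translation t ↦ t-[z] moves this point to (t-[z],-t) as well, and turns the
second bracket into K (`shift_zero_translated`). Comparing the two and cancelling K gives T(t)²
τC(t-[z])⁴ = T(t-[z])² τC(t)⁴. Constant terms settle the sign of the root, so T/τC² is invariant
under t ↦ t-[z] (`restrict_mul_shift`).

A series with this invariance is constant (`eq_C_of_subst_shift`): if t_j is the first time it
depends on, the coefficient of z^j in F(t-[z]) is -(1/j) ∂F/∂t_j. Finally, T and τC² are both
multiplied by e^φ from one site to the next, so the constant does not depend on n. -/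

theorem constantCoeff_subst_of_zero {σ υ : Type} {a : σ → MvPowerSeries υ ℂ} (ha : HasSubst a)
    (ha0 : ∀ i, constantCoeff (a i) = 0) (F : MvPowerSeries σ ℂ) :
    constantCoeff (subst a F) = constantCoeff F := by
  have h := constantCoeff_subst_eq_zero ha ha0 (f := F - C (constantCoeff F)) (by simp)
  rw [subst_sub ha, subst_C, map_sub, constantCoeff_C, sub_eq_zero] at h
  exact h

theorem hasSubst_neg {σ υ : Type} {a : σ → MvPowerSeries υ ℂ} (ha : HasSubst a) :
    HasSubst (-a) := by
  simpa using ha.mul_left (-1)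

theorem hasSubst_sub {σ υ : Type} {a b : σ → MvPowerSeries υ ℂ} (ha : HasSubst a)
    (hb : HasSubst b) : HasSubst (a - b) := by
  simpa [sub_eq_add_neg] using ha.add (hasSubst_neg hb)

theorem hasSubst_sumElim {σ σ' υ : Type} {a : σ → MvPowerSeries υ ℂ} {b : σ' → MvPowerSeries υ ℂ}
    (ha : HasSubst a) (hb : HasSubst b) : HasSubst (Sum.elim a b) where
  const_coeff := by
    rintro (i | i)
    · exact ha.const_coeff i
    · exact hb.const_coeff i
  coeff_zero d := by
    refine (((ha.coeff_zero d).image Sum.inl).union ((hb.coeff_zero d).image Sum.inr)).subset ?_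
    rintro (i | i) hi
    · exact Or.inl ⟨i, hi, rfl⟩
    · exact Or.inr ⟨i, hi, rfl⟩

theorem hasSubst_time : HasSubst (time (id : ℕ+ → ℕ+)) where
  const_coeff i := by simp [time]
  coeff_zero d := by
    classical
    have : Function.Injective fun i : ℕ+ => Finsupp.single (some i) 1 := fun i j h => by
      simpa using Finsupp.single_left_injective one_ne_zero h
    refine (Set.Finite.preimage this.injOn (Set.finite_singleton d)).subset fun i hi => ?_
    by_contra h
    exact hi (by rw [time, coeff_X, if_neg fun h' => h (by simp [h'])])

theorem hasSubst_miwa {σ : Type} : HasSubst (miwa (σ := σ)) where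
  const_coeff i := by simp [miwa]
  coeff_zero d := by
    classical
    have : Function.Injective fun i : ℕ+ => Finsupp.single (none : Option σ) (i : ℕ) :=
      fun i j h => by simpa using Finsupp.single_injective _ h
    refine (Set.Finite.preimage this.injOn (Set.finite_singleton d)).subset fun i hi => ?_
    by_contra h
    refine hi ?_
    rw [miwa, coeff_C_mul, coeff_X_pow, if_neg fun h' => h (by simp [h']), mul_zero]

@[simp]
theorem constantCoeff_time {σ : Type} (e : ℕ+ → σ) (j : ℕ+) : constantCoeff (time e j) = 0 := by
  simp [time]

@[simp]
theorem constantCoeff_miwa {σ : Type} (j : ℕ+) : constantCoeff (miwa (σ := σ) j) = 0 := by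
  simp [miwa]

/-! ### Expansion in `z` -/

theorem mapDomain_some_add_single {σ : Type} (α : σ →₀ ℕ) (l : ℕ) :
    α.mapDomain some + Finsupp.single none l = α.optionElim l := by
  ext i
  cases i with
  | none =>
    rw [Finsupp.add_apply, Finsupp.mapDomain_of_notMem_range] <;> simp
  | some i => simp [Finsupp.mapDomain_apply (Option.some_injective σ)]

/-- `expandZ` as a ring homomorphism. -/
def expandHom (σ : Type) : MvPowerSeries (Option σ) ℂ →+* WaveSeries σ where
  toFun := expandZ
  map_zero' := by
    ext α : 1
    change HahnSeries.ofPowerSeries ℤ ℂ _ = 0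
    convert map_zero (HahnSeries.ofPowerSeries ℤ ℂ)
    ext l
    simp
  map_add' F G := by
    ext α : 1
    change HahnSeries.ofPowerSeries ℤ ℂ _ = HahnSeries.ofPowerSeries ℤ ℂ _ +
      HahnSeries.ofPowerSeries ℤ ℂ _
    rw [← map_add]
    rfl
  map_one' := by
    classical
    ext α : 1
    change HahnSeries.ofPowerSeries ℤ ℂ _ = _
    have h (l : ℕ) : α.optionElim l = 0 ↔ α = 0 ∧ l = 0 := by
      rw [← not_iff_not, ← ne_eq, Finsupp.optionElim_ne_zero_iff]
      tauto
    simp_rw [mapDomain_some_add_single, coeff_one, h]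
    split_ifs with hα
    · rw [← map_one (HahnSeries.ofPowerSeries ℤ ℂ)]
      congr 1
      ext l
      simp [PowerSeries.coeff_one, hα]
    · rw [← map_zero (HahnSeries.ofPowerSeries ℤ ℂ)]
      congr 1
      ext l
      simp [hα]
  map_mul' F G := by
    classical
    ext α : 1
    rw [MvPowerSeries.coeff_mul]
    change HahnSeries.ofPowerSeries ℤ ℂ _ = ∑ p ∈ Finset.HasAntidiagonal.antidiagonal α,
      HahnSeries.ofPowerSeries ℤ ℂ _ * HahnSeries.ofPowerSeries ℤ ℂ _
    simp_rw [← map_mul, ← map_sum]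
    congr 1
    ext l
    -- Viewed as power series in z over series in the times, both sides are one double sum, over
    -- splittings of `l` and of `α`, taken in opposite orders.
    simp_rw [mapDomain_some_add_single, map_sum, PowerSeries.coeff_mul, PowerSeries.coeff_mk,
      ← coeff_coeff_optionEquivLeft, map_mul, PowerSeries.coeff_mul, map_sum,
      MvPowerSeries.coeff_mul]
    exact Finset.sum_comm

theorem coeff_expandHom {σ : Type} (F : MvPowerSeries (Option σ) ℂ) (α : σ →₀ ℕ) (l : ℕ) :
    (coeff α (expandHom σ F)).coeff (l : ℤ) = coeff (α.optionElim l) F := by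
  change (HahnSeries.ofPowerSeries ℤ ℂ _).coeff (l : ℤ) = _
  rw [HahnSeries.ofPowerSeries_apply_coeff, PowerSeries.coeff_mk, mapDomain_some_add_single]

/-- The wave relations need negative powers of z, while substitutions are made in series in the
times and z. Injectivity carries identities back once the negative powers have cancelled. -/
theorem expandHom_injective (σ : Type) : Function.Injective (expandHom σ) := by
  intro F G h
  ext β
  rw [← Finsupp.optionElim_some β, ← coeff_expandHom, ← coeff_expandHom, h]

theorem expandHom_X_none (σ : Type) : expandHom σ (X none) = zpow 1 := by
  classical
  ext α : 1
  change HahnSeries.ofPowerSeries ℤ ℂ _ = _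
  have h (l : ℕ) : α.optionElim l = Finsupp.single none 1 ↔ α = 0 ∧ l = 1 := by
    rw [← Finsupp.optionElim_zero]
    refine ⟨fun h => ⟨?_, ?_⟩, by rintro ⟨rfl, rfl⟩; rfl⟩
    · simpa using congrArg Finsupp.some h
    · simpa using DFunLike.congr_fun h none
  rw [zpow, coeff_C]
  simp_rw [mapDomain_some_add_single, coeff_X, h]
  split_ifs with hα
  · rw [← HahnSeries.ofPowerSeries_X]
    congr 1
    ext l
    simp [PowerSeries.coeff_X, hα]
  · rw [← map_zero (HahnSeries.ofPowerSeries ℤ ℂ)]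
    congr 1
    ext l
    simp [hα]

theorem coeff_subst_time (F : MvPowerSeries ℕ+ ℂ) (α : ℕ+ →₀ ℕ) (l : ℕ) :
    coeff (α.optionElim l) (subst (time id) F) = if l = 0 then coeff α F else 0 := by
  have ht : (time id : ℕ+ → MvPowerSeries (Option ℕ+) ℂ) = X ∘ Function.Embedding.some := rfl
  rw [ht, ← rename_eq_subst]
  split_ifs with hl
  · subst hl
    rw [← coeff_embDomain_rename Function.Embedding.some F α]
    congr 2
    simp [Finsupp.embDomain_eq_mapDomain, ← mapDomain_some_add_single]
  · refine coeff_rename_eq_zero _ _ ?_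
    rintro ⟨β, hβ⟩
    have h := DFunLike.congr_fun hβ none
    rw [Finsupp.mapDomain_of_notMem_range _ _ (by simp), Finsupp.optionElim_apply_none] at h
    exact hl h.symm

theorem expandHom_subst_time (F : MvPowerSeries ℕ+ ℂ) :
    expandHom ℕ+ (subst (time id) F) = const F := by
  ext α : 1
  change HahnSeries.ofPowerSeries ℤ ℂ _ = _
  rw [const, coeff_map]
  simp_rw [mapDomain_some_add_single, coeff_subst_time]
  change _ = HahnSeries.ofPowerSeries ℤ ℂ (PowerSeries.C (coeff α F))
  congr 1
  ext l
  simp [PowerSeries.coeff_C]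

theorem coeff_expandZ_time {σ : Type} [DecidableEq σ] (i : σ) (α : σ →₀ ℕ)
    (h : α ≠ Finsupp.single i 1) :
    coeff α (expandZ (X (some i))) = 0 := by
  change HahnSeries.ofPowerSeries ℤ ℂ _ = _
  rw [← map_zero (HahnSeries.ofPowerSeries ℤ ℂ)]
  congr 1
  ext l
  rw [PowerSeries.coeff_mk, mapDomain_some_add_single, coeff_X, if_neg]
  · simp
  · intro h'
    refine h ?_
    ext k
    have := DFunLike.congr_fun h' (some k)
    simpa [Finsupp.single_apply] using this

theorem constantCoeff_xi {σ : Type} (e : ℕ+ → σ) : constantCoeff (xi (time e)) = 0 := by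
  classical
  change ∑ᶠ j : ℕ+, _ = (0 : LaurentSeries ℂ)
  refine finsum_eq_zero_of_forall_eq_zero fun j => ?_
  rw [time, coeff_expandZ_time _ _ (by simp [eq_comm]), mul_zero]

theorem xi_neg {σ : Type} (t : ℕ+ → MvPowerSeries (Option σ) ℂ) : xi (-t) = -xi t := by
  ext α : 1
  have h (j : ℕ+) : coeff α (expandZ ((-t) j)) = -coeff α (expandZ (t j)) := by
    rw [Pi.neg_apply, show expandZ (-t j) = -expandZ (t j) from map_neg (expandHom σ) _, map_neg]
  have hl : coeff α (xi (-t)) = ∑ᶠ j : ℕ+,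
      HahnSeries.single (-(j : ℤ)) (1 : ℂ) * coeff α (expandZ ((-t) j)) := rfl
  have hr : coeff α (xi t) = ∑ᶠ j : ℕ+,
      HahnSeries.single (-(j : ℤ)) (1 : ℂ) * coeff α (expandZ (t j)) := rfl
  rw [map_neg, hl, hr, ← finsum_neg_distrib]
  simp_rw [h]
  congr 1
  funext j
  exact mul_neg (HahnSeries.single (-(j : ℤ)) (1 : ℂ) : LaurentSeries ℂ)
    (coeff α (expandZ (t j)))

theorem constantCoeff_expSeries {σ : Type} {F : WaveSeries σ} (hF : constantCoeff F = 0) :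
    constantCoeff (expSeries F) = 1 := by
  have h := PowerSeries.constantCoeff_subst_eq_zero hF (PowerSeries.exp ℂ - 1) (by simp)
  have hs := PowerSeries.HasSubst.of_constantCoeff_zero hF
  rw [PowerSeries.subst_sub hs, map_sub, sub_eq_zero] at h
  rw [expSeries, h, ← PowerSeries.coe_substAlgHom hs, map_one, map_one]

/-- Series over the field ℂ((z)) form a domain, so nonvanishing is enough to cancel the exponential
from the wave relations. -/
theorem expSeries_ne_zero {σ : Type} {F : WaveSeries σ} (hF : constantCoeff F = 0) :
    expSeries F ≠ 0 := fun h => by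
  simpa [h] using constantCoeff_expSeries hF

theorem zpow_add {σ : Type} (a b : ℤ) : zpow (σ := σ) (a + b) = zpow a * zpow b := by
  simp [zpow, ← map_mul]

theorem zpow_ne_zero {σ : Type} (a : ℤ) : zpow (σ := σ) a ≠ 0 := by
  intro h
  simpa [zpow] using congrArg constantCoeff h

/-! ### Series invariant under the Miwa shift -/

theorem prod_time (β : ℕ+ →₀ ℕ) :
    (β.prod fun i m => (X (some i) : MvPowerSeries (Option ℕ+) ℂ) ^ m) =
      monomial (β.optionElim 0) 1 := by
  have h := coeff_subst_time (monomial β 1)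
  rw [subst_monomial hasSubst_time, map_one, one_mul] at h
  classical
  ext α
  rw [← Finsupp.optionElim_some α]
  refine (h _ _).trans ?_
  rw [coeff_monomial, coeff_monomial]
  have key : α.some.optionElim (α none) = β.optionElim 0 ↔ α.some = β ∧ α none = 0 := by
    refine ⟨fun h => ⟨?_, ?_⟩, by rintro ⟨h, h'⟩; rw [h, h']⟩
    · simpa using congrArg Finsupp.some h
    · simpa using DFunLike.congr_fun h none
  simp only [key]
  split_ifs <;> tauto

/-- Only times t_i with i > j occur, and each is shifted by a multiple of z^i, so modulo z^(j+1) the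
shift is invisible. -/
theorem dvd_prod_shift_sub (j : ℕ+) (β : ℕ+ →₀ ℕ) (hβ : ∀ i ≤ j, β i = 0) :
    (X none : MvPowerSeries (Option ℕ+) ℂ) ^ ((j : ℕ) + 1) ∣
      (β.prod fun i m => (time id - miwa : ℕ+ → MvPowerSeries (Option ℕ+) ℂ) i ^ m) -
        β.prod fun i m => X (some i) ^ m := by
  rw [← Ideal.mem_span_singleton, ← Ideal.Quotient.eq, Finsupp.prod, Finsupp.prod, map_prod,
    map_prod]
  refine Finset.prod_congr rfl fun i hi => ?_
  rw [map_pow, map_pow]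
  congr 1
  rw [Ideal.Quotient.eq, Ideal.mem_span_singleton]
  have hij : j < i := by
    by_contra h
    exact (Finsupp.mem_support_iff.mp hi) (hβ i (not_lt.mp h))
  have : (time id - miwa : ℕ+ → MvPowerSeries (Option ℕ+) ℂ) i - X (some i) =
      X none ^ (i : ℕ) * -C (1 / ((i : ℕ) : ℂ)) := by
    simp only [Pi.sub_apply, time, miwa, id]
    ring
  rw [this]
  exact (pow_dvd_pow _ (Nat.succ_le_of_lt (by exact_mod_cast hij))).mul_right _

/-- To order z^j the shift acts on a monomial without t_i, i < j, only through its factor t_j^(β j),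
by the derivation -(z^j/j) ∂/∂t_j. -/
theorem coeff_prod_shift (j : ℕ+) (β γ : ℕ+ →₀ ℕ) (hβ : ∀ i < j, β i = 0) :
    coeff (γ.optionElim (j : ℕ))
      (β.prod fun i m => (time id - miwa : ℕ+ → MvPowerSeries (Option ℕ+) ℂ) i ^ m) =
      if β = γ + Finsupp.single j 1 then -(β j : ℂ) / (j : ℕ) else 0 := by
  classical
  set z : MvPowerSeries (Option ℕ+) ℂ := X none with hz
  obtain ⟨y, hy⟩ : ∃ y : MvPowerSeries (Option ℕ+) ℂ,
      y = -(C (1 / ((j : ℕ) : ℂ)) * z ^ (j : ℕ)) := ⟨_, rfl⟩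
  -- First-order Taylor expansion of (t_j + y)^(β j). The remainder is divisible by y², hence by
  -- z^(2j), and 2j ≥ j + 1.
  obtain ⟨k, hk⟩ := Polynomial.powAddExpansion (X (some j)) y (β j)
  obtain ⟨r, hr⟩ := dvd_prod_shift_sub j (β.erase j) fun i hi => by
    rcases hi.lt_or_eq with h | rfl
    · rw [Finsupp.erase_ne h.ne, hβ i h]
    · exact Finsupp.erase_same
  rw [prod_time, sub_eq_iff_eq_add] at hr
  have hX (m : ℕ) : (X (some j) : MvPowerSeries (Option ℕ+) ℂ) ^ m =
      monomial ((Finsupp.single j m).optionElim 0) 1 := by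
    rw [← prod_time, Finsupp.prod_single_index]
    exact pow_zero _
  have hzj : z ^ (j : ℕ) = monomial ((0 : ℕ+ →₀ ℕ).optionElim (j : ℕ)) 1 := by
    rw [hz, X_pow_eq, Finsupp.optionElim_zero]
  have hsplit : (β.prod fun i m => (time id - miwa : ℕ+ → MvPowerSeries (Option ℕ+) ℂ) i ^ m) =
      monomial (β.optionElim 0) 1 +
        C (-(β j : ℂ) / (j : ℕ)) * monomial ((β.erase j + Finsupp.single j (β j - 1)).optionElim j) 1
        + z ^ ((j : ℕ) + 1) * (k * C (1 / ((j : ℕ) : ℂ)) ^ 2 * z ^ ((j : ℕ) - 1) *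
            monomial ((β.erase j).optionElim 0) 1 + (X (some j) + y) ^ β j * r) := by
    rw [← Finsupp.mul_prod_erase' β j _ fun _ => pow_zero _, hr,
      show (time id - miwa : ℕ+ → MvPowerSeries (Option ℕ+) ℂ) j = X (some j) + y by
        simp [time, miwa, hy, hz, sub_eq_add_neg]]
    have h1 : monomial (β.optionElim 0) (1 : ℂ) =
        X (some j) ^ β j * monomial ((β.erase j).optionElim 0) 1 := by
      rw [hX, monomial_mul_monomial, ← Finsupp.optionElim_add, Finsupp.single_add_erase, one_mul]
    have h2 : monomial ((β.erase j + Finsupp.single j (β j - 1)).optionElim (j : ℕ)) (1 : ℂ) =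
        X (some j) ^ (β j - 1) * monomial ((β.erase j).optionElim 0) 1 * z ^ (j : ℕ) := by
      rw [hX, hzj, monomial_mul_monomial, monomial_mul_monomial, ← Finsupp.optionElim_add,
        ← Finsupp.optionElim_add, add_comm (β.erase j)]
      simp
    have h3 : z ^ ((j : ℕ) + 1) * z ^ ((j : ℕ) - 1) = (z ^ (j : ℕ)) ^ 2 := by
      rw [← pow_add, ← pow_mul]
      congr 1
      have := j.pos
      omega
    have h4 : C (σ := Option ℕ+) (-(β j : ℂ) / (j : ℕ)) =
        -(β j : MvPowerSeries (Option ℕ+) ℂ) * C (1 / ((j : ℕ) : ℂ)) := by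
      rw [← map_natCast (C (σ := Option ℕ+) (R := ℂ)), ← map_neg, ← map_mul]
      congr 1
      ring
    rw [h1, h2, h4]
    linear_combination (monomial ((β.erase j).optionElim 0) 1) * hk -
      k * C (1 / ((j : ℕ) : ℂ)) ^ 2 * monomial ((β.erase j).optionElim 0) 1 * h3 +
      (monomial ((β.erase j).optionElim 0) 1) * (β j * X (some j) ^ (β j - 1) +
        k * (y - C (1 / ((j : ℕ) : ℂ)) * z ^ (j : ℕ))) * hy
  have hzr (q : MvPowerSeries (Option ℕ+) ℂ) :
      coeff (γ.optionElim (j : ℕ)) (z ^ ((j : ℕ) + 1) * q) = 0 :=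
    X_pow_dvd_iff.mp (dvd_mul_right _ q) _ (by simp)
  have hne : γ.optionElim (j : ℕ) ≠ β.optionElim 0 := fun h => by
    simpa using DFunLike.congr_fun h none
  rw [hsplit, map_add, map_add, hzr, coeff_C_mul, coeff_monomial, coeff_monomial, if_neg hne,
    zero_add, add_zero]
  -- Here the exponent `β j - 1` is truncated to 0, but the scalar in front of that monomial
  -- vanishes.
  by_cases h0 : β j = 0
  · have hβγ : β ≠ γ + Finsupp.single j 1 := by
      rintro rfl
      simp at h0
    rw [if_neg hβγ, h0]
    simp
  have hiff : γ.optionElim (j : ℕ) = (β.erase j + Finsupp.single j (β j - 1)).optionElim (j : ℕ) ↔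
      β = γ + Finsupp.single j 1 := by
    have hβ' : β.erase j + Finsupp.single j (β j - 1) + Finsupp.single j 1 = β := by
      rw [add_assoc, ← Finsupp.single_add, Nat.sub_add_cancel (Nat.one_le_iff_ne_zero.mpr h0),
        Finsupp.erase_add_single]
    constructor
    · intro h
      rw [← Finsupp.some_optionElim (j : ℕ) γ, h, Finsupp.some_optionElim, hβ']
    · intro h
      congr 1
      refine add_right_cancel (b := Finsupp.single j 1) ?_
      rw [hβ', h]
  simp only [hiff, mul_ite, mul_one, mul_zero]

/-- Strong induction on j shows that no monomial containing t_j occurs: with the earlier times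
excluded, the z^j part of F(t-[z]) is -(1/j) ∂F/∂t_j, whereas F(t) has no z^j part. -/
theorem eq_C_of_subst_shift (F : MvPowerSeries ℕ+ ℂ)
    (hF : subst (time id - miwa) F = subst (time id) F) : F = C (constantCoeff F) := by
  classical
  have key (j : ℕ+) : ∀ β, β j ≠ 0 → coeff β F = 0 := by
    induction j using PNat.strongInductionOn with
    | _ j ih =>
      intro β hj
      obtain ⟨γ, rfl⟩ : ∃ γ, β = γ + Finsupp.single j 1 :=
        ⟨β - Finsupp.single j 1, (tsub_add_cancel_of_le (by simpa [Nat.one_le_iff_ne_zero])).symm⟩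
      -- At t^γ z^j the right side contributes 0. On the left, exponents containing an earlier time
      -- drop out by induction, and among the others only γ + e_j contributes.
      have h := congrArg (coeff (γ.optionElim (j : ℕ))) hF
      rw [coeff_subst_time, if_neg j.ne_zero,
        coeff_subst (hasSubst_sub hasSubst_time hasSubst_miwa),
        finsum_eq_single _ (γ + Finsupp.single j 1)] at h
      · by_cases hβ : ∀ i < j, (γ + Finsupp.single j 1 : ℕ+ →₀ ℕ) i = 0
        · rw [coeff_prod_shift _ _ _ hβ, if_pos rfl, smul_eq_mul, mul_eq_zero] at h
          refine h.resolve_right (div_ne_zero (neg_ne_zero.mpr ?_) ?_)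
          · exact_mod_cast hj
          · exact_mod_cast j.ne_zero
        · push Not at hβ
          obtain ⟨i, hi, hi'⟩ := hβ
          exact ih i hi _ hi'
      · intro β' hne
        by_cases hβ : ∀ i < j, β' i = 0
        · rw [coeff_prod_shift _ _ _ hβ, if_neg hne, smul_zero]
        · push Not at hβ
          obtain ⟨i, hi, hi'⟩ := hβ
          rw [ih i hi _ hi', zero_smul]
  ext β
  rw [coeff_C]
  split_ifs with hβ
  · rw [hβ, coeff_zero_eq_constantCoeff_apply]
  · obtain ⟨j, hj⟩ := DFunLike.ne_iff.mp hβ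
    exact key j β hj

/-! ### Comparison of the two tau-functions -/

theorem hasSubst_neg_X : HasSubst (fun j => -X j : ℕ+ → MvPowerSeries ℕ+ ℂ) :=
  hasSubst_neg HasSubst.X

theorem restrict_mul (F G : MvPowerSeries TodaTimes ℂ) :
    restrict (F * G) = restrict F * restrict G :=
  subst_mul (hasSubst_sumElim HasSubst.X hasSubst_neg_X) F G

theorem constantCoeff_restrict (F : MvPowerSeries TodaTimes ℂ) :
    constantCoeff (restrict F) = constantCoeff F :=
  constantCoeff_subst_of_zero (hasSubst_sumElim HasSubst.X hasSubst_neg_X)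
    (by rintro (i | i) <;> simp) F

theorem restrict_expPhi_mul (τ : ℤ → MvPowerSeries TodaTimes ℂ)
    (h : ∀ n, constantCoeff (τ n) ≠ 0) (n : ℤ) :
    restrict (expPhi τ n) * restrict (τ n) = restrict (τ (n + 1)) := by
  rw [← restrict_mul, expPhi, mul_assoc, MvPowerSeries.inv_mul_cancel _ (h n), mul_one]

theorem subst_time_restrict (F : MvPowerSeries TodaTimes ℂ) :
    subst (time id) (restrict F) = subst (Sum.elim (time id) (-time id)) F := by
  rw [restrict, subst_comp_subst_apply (hasSubst_sumElim HasSubst.X hasSubst_neg_X) hasSubst_time]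
  congr 1
  funext i
  rcases i with i | i
  · exact subst_X hasSubst_time i
  · change subst (time id) (-X i) = -time id i
    rw [← coe_substAlgHom hasSubst_time, map_neg, substAlgHom_X]

/-- The squared wave relation at `k → ∞`, freed of the exponential factor. -/
theorem wave_identity_inf {A : Type*} [CommRing A] [NoZeroDivisors A]
    {x z a r r' u σ c c' cp cm cm' s sm v u' v' : A} (hx : x ≠ 0)
    (hr : r * r' = 1) (hu : u * u' = 1) (hv : v * v' = 1) (hc : c * c' = 1) (hcm : cm * cm' = 1)
    (huc : u ^ 2 * c ^ 2 = cp ^ 2) (hvc : v ^ 2 * cm ^ 2 = c ^ 2)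
    (hψ : x * (a * r') = u * σ)
    (hσ : σ ^ 2 = (x * u' * s * c') ^ 2 - (z * x * v' * sm * cm') ^ 2) :
    a ^ 2 * c ^ 4 = r ^ 2 * (s ^ 2 * c ^ 2 - z ^ 2 * cp ^ 2 * sm ^ 2) := by
  have h1 : v' ^ 2 * cm' ^ 2 * c ^ 2 = 1 := by
    have : (v * v') ^ 2 * (cm * cm') ^ 2 = 1 := by rw [hv, hcm]; ring
    linear_combination this - v' ^ 2 * cm' ^ 2 * hvc
  have h2 : a ^ 2 * r' ^ 2 = s ^ 2 * c' ^ 2 - z ^ 2 * u ^ 2 * (v' ^ 2 * cm' ^ 2) * sm ^ 2 := by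
    refine mul_left_cancel₀ (pow_ne_zero 2 hx) ?_
    linear_combination (x * (a * r') + u * σ) * hψ + u ^ 2 * hσ +
      x ^ 2 * s ^ 2 * c' ^ 2 * (u * u' + 1) * hu
  linear_combination -a ^ 2 * c ^ 4 * (r * r' + 1) * hr + r ^ 2 * c ^ 4 * h2 +
    r ^ 2 * s ^ 2 * c ^ 2 * (c * c' + 1) * hc - r ^ 2 * z ^ 2 * sm ^ 2 * u ^ 2 * c ^ 2 * h1 -
    r ^ 2 * z ^ 2 * sm ^ 2 * huc

/-- The squared wave relation at `k → 0`, freed of the exponential factor. -/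
theorem wave_identity_zero {A : Type*} [CommRing A] [NoZeroDivisors A]
    {x z b r rm rm' σ c c' cm cm' p pp v : A} (hx : x ≠ 0)
    (hrm : rm * rm' = 1) (hc : c * c' = 1) (hcm : cm * cm' = 1)
    (hvr : v ^ 2 * rm = r) (hvc : v ^ 2 * cm ^ 2 = c ^ 2)
    (hψ : x * (b * rm') = v * σ)
    (hσ : σ ^ 2 = (x * p * cm') ^ 2 - (z * x * pp * c') ^ 2) :
    b ^ 2 * c ^ 4 = r ^ 2 * (p ^ 2 * c ^ 2 - z ^ 2 * cm ^ 2 * pp ^ 2) := by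
  have h1 : c ^ 2 * cm' ^ 2 = v ^ 2 := by
    linear_combination -cm' ^ 2 * hvc + v ^ 2 * (cm * cm' + 1) * hcm
  have h2 : b ^ 2 * rm' ^ 2 = v ^ 2 * (p ^ 2 * cm' ^ 2 - z ^ 2 * pp ^ 2 * c' ^ 2) := by
    refine mul_left_cancel₀ (pow_ne_zero 2 hx) ?_
    linear_combination (x * (b * rm') + v * σ) * hψ + v ^ 2 * hσ
  subst hvr
  linear_combination -b ^ 2 * c ^ 4 * (rm * rm' + 1) * hrm + rm ^ 2 * c ^ 4 * h2 +
    rm ^ 2 * v ^ 2 * c ^ 2 * p ^ 2 * h1 -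
    rm ^ 2 * v ^ 2 * z ^ 2 * pp ^ 2 * c ^ 2 * (c * c' + 1) * hc +
    rm ^ 2 * v ^ 2 * z ^ 2 * pp ^ 2 * hvc

theorem const_mul_const_inv {F : MvPowerSeries ℕ+ ℂ} (hF : constantCoeff F ≠ 0) :
    const F * (const F)⁻¹ = 1 := by
  refine MvPowerSeries.mul_inv_cancel _ ?_
  rw [const, ← coeff_zero_eq_constantCoeff_apply, coeff_map, coeff_zero_eq_constantCoeff_apply]
  exact (map_ne_zero _).mpr hF

theorem eval₁_time (F : MvPowerSeries ℕ+ ℂ) : eval₁ F (time id) = const F :=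
  expandHom_subst_time F

theorem eval₂_time (F : MvPowerSeries TodaTimes ℂ) :
    eval₂ F (time id) (-time id) = const (restrict F) := by
  rw [← expandHom_subst_time, subst_time_restrict]
  rfl

/-! ### Squared wave relations and their comparison -/

variable {τT : ℤ → MvPowerSeries TodaTimes ℂ} {τC : ℤ → MvPowerSeries ℕ+ ℂ}

theorem expPhi_mul_sq (hC : IsCTodaTau τT τC) (n : ℤ) :
    restrict (expPhi τT n) * τC n ^ 2 = τC (n + 1) ^ 2 := by
  rw [hC.expPhi_eq, ← mul_pow, mul_assoc, MvPowerSeries.inv_mul_cancel _ (hC.ne_zero n), mul_one]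

theorem constantCoeff_gauge_ne_zero (hC : IsCTodaTau τT τC) {h : ℤ → MvPowerSeries ℕ+ ℂ}
    (hh : ∀ n, h n ^ 2 = restrict (expPhi τT n)) (n : ℤ) : constantCoeff (h n) ≠ 0 := by
  intro h0
  have := congrArg constantCoeff (expPhi_mul_sq hC n)
  rw [← hh] at this
  simp only [map_mul, map_pow, h0] at this
  exact pow_ne_zero 2 (hC.ne_zero (n + 1)) (by rw [← this]; ring)

/-- After squaring, χ(n) and χ(n-1) share the factor z^(-n) e^ξ with ψ and differ by one power of z,
the source of z². The factors e^φ at n and n-1 are removed with e^φ(n) τC(n)² = τC(n+1)². -/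
theorem shift_inf (hT : IsTodaTau τT) (hC : IsCTodaTau τT τC) (n : ℤ) :
    subst (Sum.elim (time id - miwa) (-time id)) (τT n) ^ 2 * subst (time id) (τC n) ^ 4 =
      subst (time id) (restrict (τT n)) ^ 2 *
        (subst (time id - miwa) (τC n) ^ 2 * subst (time id) (τC n) ^ 2 -
          X none ^ 2 * subst (time id) (τC (n + 1)) ^ 2 *
            subst (time id - miwa) (τC (n - 1)) ^ 2) := by
  obtain ⟨h, hh, hw, -⟩ := hC.wave
  obtain ⟨σ, hσ, hψ⟩ := hw n
  apply expandHom_injective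
  simp only [map_mul, map_pow, map_sub, expandHom_subst_time, expandHom_X_none]
  have hm : zpow (σ := ℕ+) (-(n - 1)) = zpow 1 * zpow (-n) := by
    rw [← zpow_add]
    congr 1
    ring
  refine wave_identity_inf (x := zpow (-n) * expSeries (xi (time id)))
    (mul_ne_zero (zpow_ne_zero _) (expSeries_ne_zero (constantCoeff_xi _)))
    (const_mul_const_inv ((constantCoeff_restrict _).trans_ne (hT.ne_zero n)))
    (const_mul_const_inv (constantCoeff_gauge_ne_zero hC hh n))
    (const_mul_const_inv (constantCoeff_gauge_ne_zero hC hh (n - 1)))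
    (const_mul_const_inv (hC.ne_zero n)) (const_mul_const_inv (hC.ne_zero (n - 1)))
    ?_ ?_ (σ := σ) ?_ ?_
  · simp only [const, ← map_pow, ← map_mul, hh, expPhi_mul_sq hC]
  · simp only [const, ← map_pow, ← map_mul, hh, expPhi_mul_sq hC, sub_add_cancel]
  · rw [← hψ, psiInf, wInf, eval₂_time]
    rfl
  · rw [hσ, chi, chi, hm, eval₁_time, eval₁_time, mul_assoc (zpow 1)]
    rfl

theorem shift_zero (hT : IsTodaTau τT) (hC : IsCTodaTau τT τC) (n : ℤ) :
    subst (Sum.elim (time id) (-time id - miwa)) (τT n) ^ 2 * subst (time id) (τC n) ^ 4 =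
      subst (time id) (restrict (τT n)) ^ 2 *
        (subst (time id + miwa) (τC n) ^ 2 * subst (time id) (τC n) ^ 2 -
          X none ^ 2 * subst (time id) (τC (n - 1)) ^ 2 *
            subst (time id + miwa) (τC (n + 1)) ^ 2) := by
  obtain ⟨h, hh, -, hw⟩ := hC.wave
  -- At k → 0 the wave function at a site has τT of the next site in its numerator, so site n - 1 is
  -- the one that yields τT at n.
  obtain ⟨σ, hσ, hψ⟩ := hw (n - 1)
  apply expandHom_injective
  simp only [map_mul, map_pow, map_sub, expandHom_subst_time, expandHom_X_none]
  have hm : zpow (σ := ℕ+) n = zpow 1 * zpow (n - 1) := by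
    rw [← zpow_add]
    congr 1
    ring
  refine wave_identity_zero (x := zpow (n - 1) * expSeries (xi (-time id)))
    (v := const (h (n - 1)))
    (mul_ne_zero (zpow_ne_zero _) (expSeries_ne_zero (by
      rw [xi_neg, map_neg, constantCoeff_xi, neg_zero])))
    (const_mul_const_inv ((constantCoeff_restrict _).trans_ne (hT.ne_zero (n - 1))))
    (const_mul_const_inv (hC.ne_zero n)) (const_mul_const_inv (hC.ne_zero (n - 1)))
    ?_ ?_ (σ := σ) ?_ ?_
  · simp only [const, ← map_pow, ← map_mul, hh, restrict_expPhi_mul τT hT.ne_zero, sub_add_cancel]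
  · simp only [const, ← map_pow, ← map_mul, hh, expPhi_mul_sq hC, sub_add_cancel]
  · rw [← hψ, psiZero, wZero, eval₂_time, sub_add_cancel]
    rfl
  · rw [hσ, chiBar, chiBar, sub_add_cancel, hm, eval₁_time, eval₁_time, mul_assoc (zpow 1), xi_neg]
    rfl

/-- The substitution `t ↦ t - [z]` in series in the times and `z`. -/
def miwaShift : Option ℕ+ → MvPowerSeries (Option ℕ+) ℂ
  | none => X none
  | some j => (time id - miwa : ℕ+ → MvPowerSeries (Option ℕ+) ℂ) j

theorem hasSubst_miwaShift : HasSubst miwaShift where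
  const_coeff := by
    rintro (_ | j)
    · simp [miwaShift]
    · simp [miwaShift]
  coeff_zero d := by
    refine (((hasSubst_sub hasSubst_time hasSubst_miwa).coeff_zero d).image some |>.union
      (Set.finite_singleton none)).subset ?_
    rintro (_ | j) hj
    · exact Or.inr rfl
    · exact Or.inl ⟨j, hj, rfl⟩

theorem subst_miwaShift_time (j : ℕ+) :
    subst miwaShift (time id j : MvPowerSeries (Option ℕ+) ℂ) = time id j - miwa j :=
  subst_X hasSubst_miwaShift (some j)

theorem subst_miwaShift_miwa (j : ℕ+) :
    subst miwaShift (miwa j : MvPowerSeries (Option ℕ+) ℂ) = miwa j := by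
  rw [miwa, subst_mul hasSubst_miwaShift, subst_C, subst_pow hasSubst_miwaShift,
    subst_X hasSubst_miwaShift]
  rfl

theorem subst_miwaShift_subst_time (F : MvPowerSeries ℕ+ ℂ) :
    subst miwaShift (subst (time id) F) = subst (time id - miwa) F := by
  rw [subst_comp_subst_apply hasSubst_time hasSubst_miwaShift]
  simp_rw [subst_miwaShift_time]
  rfl

theorem subst_miwaShift_subst_time_add (F : MvPowerSeries ℕ+ ℂ) :
    subst miwaShift (subst (time id + miwa) F) = subst (time id) F := by
  rw [subst_comp_subst_apply (hasSubst_time.add hasSubst_miwa) hasSubst_miwaShift]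
  simp_rw [Pi.add_apply, subst_add hasSubst_miwaShift, subst_miwaShift_time, subst_miwaShift_miwa,
    sub_add_cancel]

theorem subst_miwaShift_subst_sumElim (F : MvPowerSeries TodaTimes ℂ) :
    subst miwaShift (subst (Sum.elim (time id) (-time id - miwa)) F) =
      subst (Sum.elim (time id - miwa) (-time id)) F := by
  rw [subst_comp_subst_apply (hasSubst_sumElim hasSubst_time
    (hasSubst_sub (hasSubst_neg hasSubst_time) hasSubst_miwa)) hasSubst_miwaShift]
  congr 1
  funext i
  rcases i with i | i
  · exact subst_miwaShift_time i
  · have : (-time id - miwa : ℕ+ → MvPowerSeries (Option ℕ+) ℂ) i =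
        0 - time id i - miwa i := by simp
    rw [Sum.elim_inr, Sum.elim_inr, this, subst_sub hasSubst_miwaShift,
      subst_sub hasSubst_miwaShift, subst_miwaShift_time, subst_miwaShift_miwa,
      ← coe_substAlgHom hasSubst_miwaShift, map_zero, Pi.neg_apply]
    ring

/-- The translation sends (t, -t-[z]) to (t-[z], -t) and t+[z] to t, so the left-hand τT factor and
the bracket become those of `shift_inf`. -/
theorem shift_zero_translated (hT : IsTodaTau τT) (hC : IsCTodaTau τT τC) (n : ℤ) :
    subst (Sum.elim (time id - miwa) (-time id)) (τT n) ^ 2 * subst (time id - miwa) (τC n) ^ 4 =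
      subst (time id - miwa) (restrict (τT n)) ^ 2 *
        (subst (time id) (τC n) ^ 2 * subst (time id - miwa) (τC n) ^ 2 -
          X none ^ 2 * subst (time id - miwa) (τC (n - 1)) ^ 2 *
            subst (time id) (τC (n + 1)) ^ 2) := by
  have h := congrArg (substAlgHom (R := ℂ) hasSubst_miwaShift) (shift_zero hT hC n)
  simp only [map_mul, map_pow, map_sub, substAlgHom_apply, subst_miwaShift_subst_time,
    subst_miwaShift_subst_time_add, subst_miwaShift_subst_sumElim,
    subst_X hasSubst_miwaShift] at h
  exact h

theorem restrict_mul_shift (hT : IsTodaTau τT) (hC : IsCTodaTau τT τC) (n : ℤ) :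
    subst (time id) (restrict (τT n)) * subst (time id - miwa) (τC n) ^ 2 =
      subst (time id - miwa) (restrict (τT n)) * subst (time id) (τC n) ^ 2 := by
  have hA := shift_inf hT hC n
  have hB := shift_zero_translated hT hC n
  have ht (F : MvPowerSeries ℕ+ ℂ) : constantCoeff (subst (time id) F) = constantCoeff F :=
    constantCoeff_subst_of_zero hasSubst_time (by simp) F
  have hs (F : MvPowerSeries ℕ+ ℂ) : constantCoeff (subst (time id - miwa) F) = constantCoeff F :=
    constantCoeff_subst_of_zero (hasSubst_sub hasSubst_time hasSubst_miwa) (by simp) F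
  set K := subst (time id - miwa) (τC n) ^ 2 * subst (time id) (τC n) ^ 2 -
    X none ^ 2 * subst (time id) (τC (n + 1)) ^ 2 * subst (time id - miwa) (τC (n - 1)) ^ 2 with hK
  -- At the origin with z = 0 only the first term of the bracket survives, and it equals τC(n)⁴ ≠ 0.
  have hK0 : K ≠ 0 := fun h0 => by
    have := congrArg constantCoeff (hK.symm.trans h0)
    simp [ht, hs, hC.ne_zero n] at this
  have hsq : (subst (time id) (restrict (τT n)) * subst (time id - miwa) (τC n) ^ 2) ^ 2 =
      (subst (time id - miwa) (restrict (τT n)) * subst (time id) (τC n) ^ 2) ^ 2 := by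
    refine mul_right_cancel₀ hK0 ?_
    rw [hK] at hA ⊢
    linear_combination -subst (time id - miwa) (τC n) ^ 4 * hA + subst (time id) (τC n) ^ 4 * hB
  -- Both sides have the same nonzero constant term, which excludes the minus sign.
  rcases sq_eq_sq_iff_eq_or_eq_neg.mp hsq with h | h
  · exact h
  · have := congrArg constantCoeff h
    simp only [map_mul, map_pow, map_neg, ht, hs, constantCoeff_restrict] at this
    have hne : constantCoeff (τT n) * constantCoeff (τC n) ^ 2 ≠ 0 :=
      mul_ne_zero (hT.ne_zero n) (pow_ne_zero 2 (hC.ne_zero n))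
    exact absurd (self_eq_neg.mp this) hne

theorem exists_restrict_eq (hT : IsTodaTau τT) (hC : IsCTodaTau τT τC) (n : ℤ) :
    ∃ c : ℂ, restrict (τT n) = C c * τC n ^ 2 := by
  have hs := hasSubst_sub hasSubst_time (hasSubst_miwa (σ := ℕ+))
  have hc : constantCoeff (τC n ^ 2) ≠ 0 := by
    rw [map_pow]
    exact pow_ne_zero 2 (hC.ne_zero n)
  set g := restrict (τT n) * (τC n ^ 2)⁻¹ with hg
  have hgr : restrict (τT n) = g * τC n ^ 2 := by
    rw [hg, mul_assoc, MvPowerSeries.inv_mul_cancel _ hc, mul_one]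
  have hne {a : ℕ+ → MvPowerSeries (Option ℕ+) ℂ} (ha : HasSubst a)
      (ha0 : ∀ i, constantCoeff (a i) = 0) : subst a (τC n) ≠ 0 := fun h => by
    refine hC.ne_zero n ?_
    rw [← constantCoeff_subst_of_zero ha ha0, h, map_zero]
  refine ⟨constantCoeff g, ?_⟩
  rw [← eq_C_of_subst_shift g, ← hgr]
  have h := restrict_mul_shift hT hC n
  rw [hgr, subst_mul hasSubst_time, subst_mul hs, subst_pow hasSubst_time, subst_pow hs] at h
  refine mul_right_cancel₀ (mul_ne_zero (pow_ne_zero 2 (hne hasSubst_time (by simp)))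
    (pow_ne_zero 2 (hne hs (by simp)))) ?_
  linear_combination -h

end CToda

end

/-! ### Independence of the constant from the site -/

theorem theorem2 (τT : ℤ → MvPowerSeries CToda.TodaTimes ℂ) (τC : ℤ → MvPowerSeries ℕ+ ℂ)
    (hT : CToda.IsCTodaSolution τT) (hC : CToda.IsCTodaTau τT τC) :
    ∃ C : ℂ, C ≠ 0 ∧ ∀ n : ℤ, CToda.restrict (τT n) = MvPowerSeries.C C * τC n ^ 2 := by
  choose c hc using CToda.exists_restrict_eq hT.toda hC
  -- Multiplying T(n) = c(n) τC(n)² by e^φ(n) gives T(n+1) = c(n) τC(n+1)², and the constant term of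
  -- τC(n+1) is nonzero.
  have hstep (n : ℤ) : c (n + 1) = c n := by
    have h1 := CToda.restrict_expPhi_mul τT hT.toda.ne_zero n
    have h2 := congrArg MvPowerSeries.constantCoeff
      (show MvPowerSeries.C (c n) * τC (n + 1) ^ 2 = MvPowerSeries.C (c (n + 1)) * τC (n + 1) ^ 2 by
        rw [← hc (n + 1), ← h1, hc n, ← CToda.expPhi_mul_sq hC n]
        ring)
    simp only [map_mul, map_pow, MvPowerSeries.constantCoeff_C] at h2
    exact (mul_right_cancel₀ (pow_ne_zero 2 (hC.ne_zero (n + 1))) h2).symm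
  have hconst (n : ℤ) : c n = c 0 := by
    induction n using Int.induction_on with
    | zero => rfl
    | succ n ih => rw [hstep, ih]
    | pred n ih => rw [← ih, ← hstep (-n - 1), sub_add_cancel]
  -- If the constant were 0, then T(0) and with it the constant term of τT at site 0 would vanish.
  refine ⟨c 0, fun h0 => hT.toda.ne_zero 0 ?_, fun n => by rw [hc n, hconst n]⟩
  rw [← CToda.constantCoeff_restrict, hc 0, h0]
  simp
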